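/- Let $F$ be any field, let $m$ and $n$ be positive integers, and let $R$ be a (unital) $F$-subalgebra of the algebra $\mathbb{M}_n(F)$ of $n\times n$ matrices over $F$. Write $[a,b]=ab-ba$, and define $[x_1]^*=x_1$ and $[x_1,\dots,x_k]^*=[[x_1,\dots,x_{k-1}]^*,x_k]$ for $k>1$. Suppose that $R$ is Lie nilpotent of index $m$, that is, $[x_1,x_2,\dots,x_{m+1}]^*=0$ for all $x_1,\dots,x_{m+1}\in R$. Then $$\dim_F R\le M(m+1,n),$$ where, for positive integers $\ell$ and $n$, $$M(\ell,n)=\max\Big\{\tfrac12\Big(n^2-\sum_{i=1}^{\ell}k_i^2\Big)+1 : k_1,\dots,k_\ell\text{ are nonnegative integers with }\sum_{i=1}^{\ell}k_i=n\Big\}.$$ Moreover $M(2,n)=\lfloor n^2/4\rfloor+1$, so the case $m=1$ is the Schur–Jacobson theorem: every commutative $F$-subalgebra $R$ of $\mathbb{M}_n(F)$ satisfies $\dim_F R\le\lfloor n^2/4\rfloor+1$. -/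

import Mathlib

/-- The left-normed bracket `[x₀, x₁, …, x_k]* = [… [[x₀, x₁], x₂], …, x_k]` of the first `k + 1`
terms of a sequence `x` in a ring, where `⁅a, b⁆` is the commutator `a * b - b * a`. -/
def leftNormedBracket {R : Type*} [Ring R] (x : ℕ → R) : ℕ → R
  | 0 => x 0
  | k + 1 => ⁅leftNormedBracket x k, x (k + 1)⁆

/-- A ring `R` is Lie nilpotent of index `m` if every left-normed commutator
`[x₀, x₁, …, x_m]*` of `m + 1` elements of `R` vanishes. (Smaller `m` is allowed to work too.) -/
def IsLieNilpotentOfIndex (R : Type*) [Ring R] (m : ℕ) : Prop :=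
  ∀ x : ℕ → R, leftNormedBracket x m = 0

/-- The values `½ (n² - ∑ kᵢ²) + 1`, for nonnegative integers `k₁, …, k_ℓ` with sum `n`. -/
def lieBoundSet (l n : ℕ) : Set ℝ :=
  {r | ∃ k : Fin l → ℕ, ∑ i, k i = n ∧
    r = 1 / 2 * ((n : ℝ) ^ 2 - ∑ i, (k i : ℝ) ^ 2) + 1}

/-- `M(ℓ, n)`, the maximum of `lieBoundSet ℓ n` (for `ℓ ≥ 1`; see `lieBound_isGreatest`). -/
noncomputable def lieBound (l n : ℕ) : ℝ := sSup (lieBoundSet l n)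

/-- For `ℓ ≥ 1` the supremum defining `M(ℓ, n)` is a maximum. -/
theorem lieBound_isGreatest (l n : ℕ) (hl : 0 < l) :
    IsGreatest (lieBoundSet l n) (lieBound l n) := by
  have hfin : (lieBoundSet l n).Finite := by
    refine ((Finset.finite_toSet (Finset.piAntidiag (Finset.univ : Finset (Fin l)) n)).image
      (fun k => 1 / 2 * ((n : ℝ) ^ 2 - ∑ i, (k i : ℝ) ^ 2) + 1)).subset ?_
    rintro r ⟨k, hk, rfl⟩
    exact ⟨k, by simp [hk], rfl⟩
  have hne : (lieBoundSet l n).Nonempty :=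
    ⟨_, Pi.single (⟨0, hl⟩ : Fin l) n, by simp, rfl⟩
  exact ⟨hne.csSup_mem hfin, fun r hr => le_csSup hfin.bddAbove hr⟩

/-!
The bound is first proved for a nilpotent space `J` of endomorphisms of `V` that is closed under
multiplication and in which all brackets of `m + 1` elements vanish. Let `U` be a complement of
`W = J V` in `V`. Restriction to `U` maps `J` to `Hom(U, W)`, of dimension `dim U * dim W`, and its
kernel `K` acts faithfully on `W`. The point is that `K` satisfies a shorter identity: a bracket `c`
of `m` elements of `K` kills `U`, so `0 = [c, s] u = c (s u)` for all `s ∈ J` and `u ∈ U`, and since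
`V = U + J U` by Nakayama's lemma, `c = 0`. By induction on `m` the dimension of `J` is at most
`∑_{i < j} kᵢ kⱼ = ½ (n² - ∑ kᵢ²)` with `k₀ = dim U`. See `exists_sum_sq_le_of_restrict` and
`exists_sum_sq_le_of_nilpotent`.

A Lie nilpotent algebra `R ⊆ End V` has only central idempotents
(`IsLieNilpotentOfIndex.commute_of_idempotent`), so that `V` and `R` split along them, and the bound
is superadditive in `n` (`exists_sum_sq_add`). This leaves algebras without nontrivial idempotents,
whose elements outside the Jacobson radical `J` are invertible. The same restriction step, now with
a subspace `U` that generates `V` over `R`, then gives the bound for `R`, over any field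
and without assuming that `R / J` is `F` (`exists_sum_sq_le_of_idempotent_trivial`). The inequality
is kept in the form `2 * dim R + ∑ kᵢ² ≤ n² + 2` between natural numbers.
-/

open Module

/-! ### Left-normed brackets -/

theorem leftNormedBracket_congr {A : Type*} [Ring A] {x y : ℕ → A} {k : ℕ}
    (h : ∀ i ≤ k, x i = y i) : leftNormedBracket x k = leftNormedBracket y k := by
  induction k with
  | zero => exact h 0 le_rfl
  | succ k ih =>
    simp only [leftNormedBracket]
    rw [ih fun i hi => h i (by omega), h (k + 1) le_rfl]

theorem map_leftNormedBracket {A B : Type*} [Ring A] [Ring B] (f : A →+* B) (x : ℕ → A) (k : ℕ) :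
    f (leftNormedBracket x k) = leftNormedBracket (fun i => f (x i)) k := by
  induction k with
  | zero => rfl
  | succ k ih => simp [leftNormedBracket, Ring.lie_def, ih]

theorem leftNormedBracket_mem {F A : Type*} [Field F] [Ring A] [Algebra F A] {K : Submodule F A}
    (hK : ∀ a ∈ K, ∀ b ∈ K, a * b ∈ K) {x : ℕ → A} (hx : ∀ i, x i ∈ K) (k : ℕ) :
    leftNormedBracket x k ∈ K := by
  induction k with
  | zero => exact hx 0
  | succ k ih =>
    rw [leftNormedBracket, Ring.lie_def]
    exact K.sub_mem (hK _ ih _ (hx _)) (hK _ (hx _) _ ih)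

theorem IsLieNilpotentOfIndex.of_surjective {A B : Type*} [Ring A] [Ring B] {m : ℕ}
    (hA : IsLieNilpotentOfIndex A m) (f : A →+* B) (hf : Function.Surjective f) :
    IsLieNilpotentOfIndex B m := by
  intro x
  choose y hy using fun i => hf (x i)
  have := map_leftNormedBracket f y m
  rw [hA y, map_zero] at this
  simpa [hy] using this.symm

/-- In a Lie nilpotent ring every idempotent `e` is central: for `y = e * x * (1 - e)` bracketing
with `e` maps `y` to `-y`, and for `y = (1 - e) * x * e` it maps `y` to itself, so that iterated
brackets with `e` vanish only if `y = 0`. -/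
theorem IsLieNilpotentOfIndex.commute_of_idempotent {A : Type*} [Ring A] {m : ℕ}
    (hA : IsLieNilpotentOfIndex A m) {e : A} (he : e * e = e) (x : A) : e * x = x * e := by
  have key : ∀ (y : A) (ε : ℤˣ), ⁅y, e⁆ = ε • y → y = 0 := by
    intro y ε hy
    have h : ∀ k, leftNormedBracket (fun i => if i = 0 then y else e) k = ε ^ k • y := by
      intro k
      induction k with
      | zero => simp [leftNormedBracket]
      | succ k ih =>
        rw [leftNormedBracket, ih, if_neg k.succ_ne_zero, Ring.lie_def]
        rw [Units.smul_def, smul_mul_assoc, mul_smul_comm, ← smul_sub, ← Ring.lie_def, hy,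
          ← Units.smul_def, smul_smul, pow_succ]
    have h0 := (h m).symm.trans (hA _)
    exact (smul_eq_zero_iff_eq (ε ^ m)).mp h0
  have h1 : e * x * (1 - e) = 0 := by
    refine key _ (-1) ?_
    simp only [Ring.lie_def, mul_sub, sub_mul, mul_one, ← mul_assoc, he]
    simp only [mul_assoc, he, Units.neg_smul, one_smul]
    abel
  have h2 : (1 - e) * x * e = 0 := by
    refine key _ 1 ?_
    simp only [Ring.lie_def, mul_sub, sub_mul, one_mul, ← mul_assoc, he]
    simp only [mul_assoc, he, one_smul]
    abel
  rw [mul_sub, mul_one, sub_eq_zero] at h1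
  rw [sub_mul, sub_mul, one_mul, sub_eq_zero] at h2
  rw [h1, h2]

/-! ### Restriction of endomorphisms to an invariant subspace -/

section Restrict
variable {F V : Type*} [Field F] [AddCommGroup V] [Module F V]

/-- The algebra of endomorphisms of `V` that map the subspace `W` into itself. -/
def endStabilizer (W : Submodule F V) : Subalgebra F (End F V) where
  carrier := {f | ∀ v ∈ W, f v ∈ W}
  mul_mem' ha hb v hv := ha _ (hb v hv)
  add_mem' ha hb v hv := W.add_mem (ha v hv) (hb v hv)
  algebraMap_mem' r v hv := by
    rw [Module.algebraMap_end_apply]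
    exact W.smul_mem r hv

/-- Restriction to `W` of the endomorphisms that map `W` into itself. -/
def restrictEnd (W : Submodule F V) : endStabilizer W →ₐ[F] End F W where
  toFun f := (f : End F V).restrict f.2
  map_one' := rfl
  map_mul' _ _ := rfl
  map_zero' := rfl
  map_add' _ _ := rfl
  commutes' _ := rfl

theorem Submodule.pow_eq_bot_map_restrictEnd {K : Submodule F (End F V)} {N : ℕ} (hN : K ^ N = ⊥)
    (W : Submodule F V) :
    ((K.comap (endStabilizer W).val.toLinearMap).map (restrictEnd W).toLinearMap) ^ N = ⊥ := by
  rw [← Submodule.map_pow]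
  have h : (K.comap (endStabilizer W).val.toLinearMap) ^ N = ⊥ := by
    apply Submodule.map_injective_of_injective
      (f := (endStabilizer W).val.toLinearMap) Subtype.val_injective
    rw [Submodule.map_pow, Submodule.map_bot, eq_bot_iff, ← hN]
    exact pow_le_pow_left' (Submodule.map_comap_le _ _) N
  rw [h, Submodule.map_bot]

end Restrict

/-! ### Nilpotent spaces of endomorphisms -/

section Nilpotent
variable {F V : Type*} [Field F] [AddCommGroup V] [Module F V]

/-- The subspace `J V` of `V` spanned by the images of the endomorphisms in `J`. -/
def imageSpan (J : Submodule F (End F V)) : Submodule F V := ⨆ f : J, LinearMap.range (f : End F V)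

theorem apply_mem_imageSpan {J : Submodule F (End F V)} {f : End F V} (hf : f ∈ J) (v : V) :
    f v ∈ imageSpan J :=
  Submodule.mem_iSup_of_mem (⟨f, hf⟩ : J) ⟨v, rfl⟩

theorem imageSpan_le {J : Submodule F (End F V)} {W : Submodule F V}
    (h : ∀ f ∈ J, ∀ v, f v ∈ W) : imageSpan J ≤ W := by
  refine iSup_le fun f => ?_
  rintro _ ⟨v, rfl⟩
  exact h f f.2 v

/-- Nakayama's lemma for a nilpotent `J`: if `V = X + J V`, then an endomorphism that vanishes on
all `J ^ n X` is zero. -/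
theorem eq_zero_of_sup_imageSpan_eq_top {J : Submodule F (End F V)} {N : ℕ} (hN : J ^ N = ⊥)
    {X : Submodule F V} (hX : X ⊔ imageSpan J = ⊤) {c : End F V}
    (hc : ∀ n, ∀ g ∈ J ^ n, ∀ x ∈ X, c (g x) = 0) : c = 0 := by
  -- Descending induction on the exponent, from `J ^ N = ⊥` to `J ^ 0 ∋ 1`.
  have main : ∀ j ≤ N, ∀ g ∈ J ^ (N - j), c * g = 0 := by
    intro j
    induction j with
    | zero =>
      intro _ g hg
      rw [Nat.sub_zero, hN, Submodule.mem_bot] at hg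
      rw [hg, mul_zero]
    | succ j ih =>
      intro hj g hg
      have hker : X ⊔ imageSpan J ≤ LinearMap.ker (c * g) := by
        refine sup_le (fun x hx => hc _ g hg x hx) (imageSpan_le fun f hf v => ?_)
        have hgf : g * f ∈ J ^ (N - j) := by
          rw [show N - j = (N - (j + 1)) + 1 by omega, pow_succ]
          exact Submodule.mul_mem_mul hg hf
        have := LinearMap.congr_fun (ih (by omega) _ hgf) v
        simpa using this
      rw [hX, top_le_iff] at hker
      exact LinearMap.ker_eq_top.mp hker
  have h1 : (1 : End F V) ∈ J ^ (N - N) := by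
    rw [Nat.sub_self, pow_zero]
    exact Submodule.one_le.mp le_rfl
  simpa using main N le_rfl 1 h1

end Nilpotent

/-! ### The dimension of nilpotent spaces of endomorphisms -/

section Bound
universe u v
variable {F : Type u} [Field F]

/-- The recursive step of the dimension count. The restriction map `J → Hom(U, J V)` has a kernel
`K` that acts faithfully on `W`, since `V = U + W`. If `c` is a bracket of `m + 1` elements of `K`,
then for `s ∈ A` and `u ∈ U` one has `0 = [c, s] u = c (s u)`, because `c u = 0`; as `U` generates
`V` under `A`, this gives `c = 0`. So `K` satisfies an identity with one entry fewer than `A`. -/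
theorem exists_sum_sq_le_of_restrict {V : Type v} [AddCommGroup V] [Module F V]
    [FiniteDimensional F V] {A J : Submodule F (End F V)} {U W : Submodule F V} {m N : ℕ}
    (hJA : J ≤ A) (hJ : ∀ a ∈ J, ∀ b ∈ J, a * b ∈ J) (hN : J ^ N = ⊥)
    (hUW : U ⊔ W = ⊤) (hW : imageSpan J ≤ W)
    (hgen : ∀ c : End F V, (∀ u ∈ U, c u = 0) → (∀ s ∈ A, ∀ u ∈ U, c (s u) = 0) → c = 0)
    (hlie : ∀ x : ℕ → End F V, (∀ i, x i ∈ A) → leftNormedBracket x (m + 1) = 0)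
    (ih : ∀ K : Submodule F (End F W), (∀ a ∈ K, ∀ b ∈ K, a * b ∈ K) → K ^ N = ⊥ →
      (∀ x : ℕ → End F W, (∀ i, x i ∈ K) → leftNormedBracket x m = 0) →
      ∃ k : Fin (m + 1) → ℕ, ∑ i, k i = finrank F W ∧
        2 * finrank F K + ∑ i, k i ^ 2 ≤ finrank F W ^ 2) :
    ∃ k : Fin (m + 1) → ℕ, ∑ i, k i = finrank F W ∧
      2 * finrank F J + ∑ i, k i ^ 2 ≤
        2 * (finrank F U * finrank F (imageSpan J)) + finrank F W ^ 2 := by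
  let φ : J →ₗ[F] (U →ₗ[F] imageSpan J) :=
    { toFun := fun f => (f : End F V).restrict (p := U) fun v _ => apply_mem_imageSpan f.2 v
      map_add' := fun _ _ => rfl
      map_smul' := fun _ _ => rfl }
  let K : Submodule F (End F V) := (LinearMap.ker φ).map J.subtype
  have mem_K : ∀ f, f ∈ K ↔ f ∈ J ∧ ∀ u ∈ U, f u = 0 := by
    intro f
    constructor
    · rintro ⟨g, hg, rfl⟩
      refine ⟨g.2, fun u hu => ?_⟩
      have := LinearMap.congr_fun (LinearMap.mem_ker.mp hg) ⟨u, hu⟩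
      exact congrArg Subtype.val this
    · rintro ⟨hf, hu⟩
      refine ⟨⟨f, hf⟩, LinearMap.mem_ker.mpr ?_, rfl⟩
      ext u
      exact hu u u.2
  have hKJ : K ≤ J := fun f hf => ((mem_K f).mp hf).1
  have hKmul : ∀ a ∈ K, ∀ b ∈ K, a * b ∈ K := fun a ha b hb =>
    (mem_K _).mpr ⟨hJ a (hKJ ha) b (hKJ hb), fun u hu => by
      rw [Module.End.mul_apply, ((mem_K b).mp hb).2 u hu, map_zero]⟩
  have hKlie : ∀ x : ℕ → End F V, (∀ i, x i ∈ K) → leftNormedBracket x m = 0 := by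
    intro x hx
    have hc := (mem_K _).mp (leftNormedBracket_mem hKmul hx m)
    refine hgen _ hc.2 fun s hs u hu => ?_
    have h := hlie (Function.update x (m + 1) s) fun i => by
      by_cases hi : i = m + 1
      · subst hi; simpa using hs
      · rw [Function.update_of_ne hi]; exact hJA (hKJ (hx i))
    rw [leftNormedBracket, Function.update_self, leftNormedBracket_congr (y := x) fun i hi =>
      Function.update_of_ne (by omega) _ _, Ring.lie_def] at h
    simpa [hc.2 u hu] using LinearMap.congr_fun h u
  have hstab : K ≤ Subalgebra.toSubmodule (endStabilizer W) := fun f hf v _ =>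
    hW (apply_mem_imageSpan (hKJ hf) v)
  let K' : Submodule F (End F W) :=
    (K.comap (endStabilizer W).val.toLinearMap).map (restrictEnd W).toLinearMap
  have mem_K' : ∀ g, g ∈ K' → ∃ f : endStabilizer W, (f : End F V) ∈ K ∧ restrictEnd W f = g :=
    fun g ⟨f, hf, hfg⟩ => ⟨f, hf, hfg⟩
  obtain ⟨k, hk, hle⟩ := ih K'
    (by
      intro a ha b hb
      obtain ⟨f, hf, rfl⟩ := mem_K' a ha
      obtain ⟨g, hg, rfl⟩ := mem_K' b hb
      exact ⟨f * g, hKmul _ hf _ hg, map_mul (restrictEnd W) f g⟩)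
    (Submodule.pow_eq_bot_map_restrictEnd
      (eq_bot_iff.mpr ((pow_le_pow_left' hKJ N).trans hN.le)) W)
    (by
      intro x hx
      choose y hy hyx using fun i => mem_K' _ (hx i)
      have h1 : leftNormedBracket y m = 0 := by
        apply Subtype.val_injective
        have := map_leftNormedBracket (endStabilizer W).val.toRingHom y m
        exact this.trans (hKlie _ hy)
      have h2 := map_leftNormedBracket (restrictEnd W).toRingHom y m
      rw [h1, map_zero] at h2
      rw [h2]
      exact leftNormedBracket_congr fun i _ => (hyx i).symm)
  refine ⟨k, hk, ?_⟩
  have hKK' : finrank F K ≤ finrank F K' := by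
    let ψ : K →ₗ[F] K' :=
      ((restrictEnd W).toLinearMap ∘ₗ Submodule.inclusion hstab).codRestrict K' fun f =>
        ⟨⟨f, hstab f.2⟩, f.2, rfl⟩
    refine LinearMap.finrank_le_finrank_of_injective (f := ψ)
      ((injective_iff_map_eq_zero ψ).mpr fun f hf => ?_)
    have hfW : ∀ w : W, (f : End F V) w = 0 := fun w =>
      congrArg Subtype.val (LinearMap.congr_fun (congrArg Subtype.val hf) w)
    have hker : U ⊔ W ≤ LinearMap.ker (f : End F V) :=
      sup_le ((mem_K _).mp f.2).2 fun w hw => hfW ⟨w, hw⟩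
    rw [hUW, top_le_iff] at hker
    exact Subtype.ext (LinearMap.ker_eq_top.mp hker)
  have hK : finrank F K = finrank F (LinearMap.ker φ) :=
    Submodule.finrank_map_subtype_eq _ _
  have hrange : finrank F (LinearMap.range φ) ≤ finrank F U * finrank F (imageSpan J) := by
    rw [← Module.finrank_linearMap F F U (imageSpan J)]
    exact Submodule.finrank_le _
  have := LinearMap.finrank_range_add_finrank_ker φ
  omega

/-- A nilpotent space `J` of endomorphisms that is closed under multiplication and in which all
brackets of `m + 1` elements vanish has dimension at most `½ (n² - ∑ kᵢ²)` for some
`k₀ + … + k_m = n = dim V`; here `k₀` is the dimension of `V / J V`. -/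
theorem exists_sum_sq_le_of_nilpotent (m : ℕ) {V : Type v} [AddCommGroup V] [Module F V]
    [FiniteDimensional F V] {J : Submodule F (End F V)} {N : ℕ}
    (hJ : ∀ a ∈ J, ∀ b ∈ J, a * b ∈ J) (hN : J ^ N = ⊥)
    (hlie : ∀ x : ℕ → End F V, (∀ i, x i ∈ J) → leftNormedBracket x m = 0) :
    ∃ k : Fin (m + 1) → ℕ, ∑ i, k i = finrank F V ∧
      2 * finrank F J + ∑ i, k i ^ 2 ≤ finrank F V ^ 2 := by
  induction m generalizing V with
  | zero =>
    have hbot : J = ⊥ := (Submodule.eq_bot_iff _).mpr fun a ha => hlie (fun _ => a) fun _ => ha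
    subst hbot
    exact ⟨fun _ => finrank F V, by simp, by simp⟩
  | succ m ih =>
    obtain ⟨U, hU⟩ := Submodule.exists_isCompl (imageSpan J)
    have hpow : ∀ n, ∀ g ∈ J ^ (n + 1), g ∈ J := by
      intro n
      induction n with
      | zero => simp
      | succ n ihn =>
        intro g hg
        rw [pow_succ] at hg
        exact Submodule.mul_le.mpr (fun a ha b hb => hJ a (ihn a ha) b hb) hg
    obtain ⟨k, hk, hle⟩ := exists_sum_sq_le_of_restrict (U := U) (W := imageSpan J) le_rfl hJ hN
      hU.symm.sup_eq_top le_rfl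
      (by
        intro c hcU hcJ
        refine eq_zero_of_sup_imageSpan_eq_top hN hU.symm.sup_eq_top fun n g hg x hx => ?_
        cases n with
        | zero =>
          obtain ⟨r, rfl⟩ := Submodule.mem_one.mp (by simpa only [pow_zero] using hg)
          simp [Module.algebraMap_end_apply, hcU x hx]
        | succ n => exact hcJ g (hpow n g hg) x hx)
      hlie fun K hK hKN hKlie => ih hK hKN hKlie
    refine ⟨Fin.cons (finrank F U) k, ?_, ?_⟩
    · rw [Fin.sum_univ_succ]
      simp only [Fin.cons_zero, Fin.cons_succ, hk]
      rw [add_comm]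
      exact Submodule.finrank_add_eq_of_isCompl hU
    · rw [Fin.sum_univ_succ, ← Submodule.finrank_add_eq_of_isCompl hU]
      simp only [Fin.cons_zero, Fin.cons_succ]
      nlinarith

end Bound

/-! ### Algebras without nontrivial idempotents -/

section Local
universe u v
variable {F : Type u} [Field F]

/-- If a finite-dimensional algebra has no idempotents besides `0` and `1`, each of its elements is
nilpotent or invertible. Writing an annihilating polynomial of `a` as `X ^ k * q` with `q` prime to
`X` gives, by Bézout, an idempotent polynomial expression in `a`. -/
theorem isNilpotent_or_isUnit_of_idempotent_trivial {A : Type*} [Ring A] [Algebra F A]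
    [FiniteDimensional F A] (h : ∀ e : A, e * e = e → e = 0 ∨ e = 1) (a : A) :
    IsNilpotent a ∨ IsUnit a := by
  open Polynomial in
  obtain ⟨p, hp, hpa⟩ : ∃ p : F[X], p.Monic ∧ aeval a p = 0 := Algebra.IsIntegral.isIntegral a
  obtain ⟨q, hpq, hq⟩ := p.exists_eq_pow_rootMultiplicity_mul_and_not_dvd hp.ne_zero 0
  rw [C_0, sub_zero] at hpq hq
  set k := p.rootMultiplicity 0
  have hcop : IsCoprime (X ^ (k + 1)) q :=
    ((Irreducible.coprime_iff_not_dvd irreducible_X).mpr hq).pow_left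
  obtain ⟨b, c, hbc⟩ := hcop
  have hzero : aeval a (X ^ (k + 1) * q) = 0 := by
    rw [pow_succ', mul_assoc, ← hpq, map_mul, hpa, mul_zero]
  have hidem : aeval a (b * X ^ (k + 1)) * aeval a (b * X ^ (k + 1)) =
      aeval a (b * X ^ (k + 1)) := by
    have h1 : b * X ^ (k + 1) * (b * X ^ (k + 1)) =
        b * X ^ (k + 1) - b * c * (X ^ (k + 1) * q) := by
      linear_combination (b * X ^ (k + 1)) * hbc
    rw [← map_mul, h1, map_sub, map_mul (aeval a) (b * c), hzero, mul_zero, sub_zero]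
  rcases h _ hidem with h0 | h1
  · left
    refine ⟨k + 1, ?_⟩
    have h2 : X ^ (k + 1) = X ^ (k + 1) * (b * X ^ (k + 1)) + c * (X ^ (k + 1) * q) := by
      linear_combination -X ^ (k + 1) * hbc
    have h3 := congrArg (aeval a) h2
    rw [map_add, map_mul _ _ (b * _), h0, map_mul _ c, hzero, mul_zero, mul_zero, add_zero] at h3
    simpa using h3
  · right
    have hl : aeval a (b * X ^ k) * a = 1 := by
      rw [← h1, pow_succ, ← mul_assoc, map_mul _ (b * X ^ k), aeval_X]
    have hr : a * aeval a (b * X ^ k) = 1 := by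
      have hcomm : aeval a (X * (b * X ^ k)) = aeval a (b * X ^ k * X) := by rw [mul_comm]
      rw [map_mul, map_mul _ (b * X ^ k), aeval_X] at hcomm
      rw [hcomm, hl]
    exact ⟨⟨a, _, hr, hl⟩, rfl⟩

/-- If all elements of a ring are nilpotent or invertible, those that are not invertible lie in the
Jacobson radical. -/
theorem mem_jacobson_or_isUnit {A : Type*} [Ring A]
    (h : ∀ a : A, IsNilpotent a ∨ IsUnit a) (a : A) : a ∈ Ring.jacobson A ∨ IsUnit a := by
  by_cases ha : IsUnit a
  · exact .inr ha
  left
  obtain ⟨k, hk⟩ := (h a).resolve_right ha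
  rw [← Ideal.jacobson_bot, Ideal.mem_jacobson_iff]
  intro y
  have hnil : IsNilpotent (y * a) := by
    refine (h _).resolve_right fun hu => ha ?_
    -- `y * a` is a unit, so `a` is left cancellable; being nilpotent, it is then zero.
    have hcancel : ∀ j, a ^ j = 0 → a ^ 0 = 0 := by
      intro j
      induction j with
      | zero => exact id
      | succ j ih =>
        intro hj
        refine ih (hu.mul_left_cancel ?_)
        rw [mul_assoc, ← pow_succ', hj, mul_zero, mul_zero]
    have h10 : (1 : A) = 0 := by simpa using hcancel k hk
    exact ⟨⟨a, 0, by rw [mul_zero, h10], by rw [zero_mul, h10]⟩, rfl⟩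
  obtain ⟨z, hz⟩ := hnil.isUnit_one_add.exists_left_inv
  refine ⟨z, ?_⟩
  rw [Submodule.mem_bot, mul_assoc, ← hz]
  noncomm_ring

variable {V : Type v} [AddCommGroup V] [Module F V] [FiniteDimensional F V]

/-- A subalgebra of `End V` without nontrivial idempotents has a nilpotent two-sided ideal outside
of which every element is invertible, namely its Jacobson radical. -/
theorem exists_nilpotent_ideal_of_idempotent_trivial {R : Subalgebra F (End F V)}
    (h : ∀ e ∈ R, e * e = e → e = 0 ∨ e = 1) :
    ∃ J : Submodule F (End F V), J ≤ Subalgebra.toSubmodule R ∧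
      (∀ a ∈ R, ∀ b ∈ J, a * b ∈ J) ∧ (∀ a ∈ J, ∀ b ∈ R, a * b ∈ J) ∧ (∃ N, J ^ N = ⊥) ∧
      ∀ a ∈ R, a ∈ J ∨ ∃ b ∈ R, b * a = 1 := by
  have hunit := mem_jacobson_or_isUnit (isNilpotent_or_isUnit_of_idempotent_trivial (F := F)
    (A := R) fun e he =>
      (h e e.2 (congrArg Subtype.val he)).imp (fun h0 => Subtype.ext h0) fun h1 => Subtype.ext h1)
  have : IsArtinianRing R := IsArtinianRing.of_finite F R
  obtain ⟨N, hN⟩ := IsSemiprimaryRing.isNilpotent (R := R)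
  have hN' : Ring.jacobson R ^ (N + 1) = 0 := by rw [Submodule.pow_succ, hN, zero_mul]
  refine ⟨((Ring.jacobson R).restrictScalars F).map R.val.toLinearMap, ?_, ?_, ?_, ⟨N + 1, ?_⟩, ?_⟩
  · rintro _ ⟨a, _, rfl⟩
    exact a.2
  · rintro a ha _ ⟨b, hb, rfl⟩
    exact ⟨⟨a, ha⟩ * b, (Ring.jacobson R).mul_mem_left _ hb, rfl⟩
  · rintro _ ⟨a, ha, rfl⟩ b hb
    exact ⟨a * ⟨b, hb⟩, Ideal.mul_mem_right _ _ ha, rfl⟩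
  · rw [← Submodule.map_pow, ← Submodule.restrictScalars_pow N.succ_ne_zero, hN']
    simp
  · intro a ha
    rcases hunit ⟨a, ha⟩ with hJ | hu
    · exact .inl ⟨_, hJ, rfl⟩
    · obtain ⟨b, hb⟩ := hu.exists_left_inv
      exact .inr ⟨b, b.2, congrArg Subtype.val hb⟩

/-- The dimension bound for a Lie nilpotent subalgebra without nontrivial idempotents. With `J` the
radical and `W = J V`, take `v ∉ W` and let `U` be the sum of the line `F v` and a complement of
`R v + W`. Then `U` generates `V` under `R` and meets `W` trivially. The residue division ring
`R / J` need not be `F`; its dimension `d` is the dimension of `R v` modulo `W`, so that enlarging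
`W` to a complement of `U` gains exactly the `d - 1` dimensions that `U` lacks. -/
theorem exists_sum_sq_le_of_idempotent_trivial {R : Subalgebra F (End F V)} {m : ℕ} [Nontrivial V]
    (h : ∀ e ∈ R, e * e = e → e = 0 ∨ e = 1)
    (hlie : ∀ x : ℕ → End F V, (∀ i, x i ∈ R) → leftNormedBracket x (m + 1) = 0) :
    ∃ k : Fin (m + 2) → ℕ, ∑ i, k i = finrank F V ∧
      2 * finrank F R + ∑ i, k i ^ 2 ≤ finrank F V ^ 2 + 2 := by
  obtain ⟨J, hJR, hJl, hJr, ⟨N, hN⟩, hinv⟩ := exists_nilpotent_ideal_of_idempotent_trivial h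
  set W := imageSpan J with hWdef
  have hRW : ∀ r ∈ R, ∀ w ∈ W, r w ∈ W := by
    intro r hr
    refine imageSpan_le (W := W.comap r) fun f hf v => ?_
    exact apply_mem_imageSpan (hJl r hr f hf) v
  have hJpow : ∀ n, ∀ g ∈ J ^ n, g ∈ R := fun n g hg => by
    have h1 : J ^ n ≤ Subalgebra.toSubmodule R := by
      clear hg
      induction n with
      | zero => rw [pow_zero]; exact Submodule.one_le.mpr R.one_mem
      | succ n ih =>
        rw [pow_succ]
        exact Submodule.mul_le.mpr fun a ha b hb => R.mul_mem (ih ha) (hJR hb)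
    exact h1 hg
  obtain ⟨v, hv⟩ : ∃ v, v ∉ W := by
    by_contra! hall
    have : (1 : End F V) = 0 := eq_zero_of_sup_imageSpan_eq_top hN (X := ⊥)
      (by rw [bot_sup_eq, eq_top_iff]; exact fun v _ => hall v)
      (by rintro n g - x hx; simp [(Submodule.mem_bot F).mp hx])
    exact one_ne_zero this
  let ψ : (R × W) →ₗ[F] V :=
    ((LinearMap.applyₗ v) ∘ₗ R.val.toLinearMap).coprod W.subtype
  have hψ : ∀ r w, ψ (r, w) = (r : End F V) v + w := fun r w => rfl
  set X := LinearMap.range ψ with hX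
  have hWX : W ≤ X := fun w hw => ⟨(0, ⟨w, hw⟩), by simp [hψ]⟩
  have hRX : ∀ r ∈ R, r v ∈ X := fun r hr => ⟨(⟨r, hr⟩, 0), by simp [hψ]⟩
  obtain ⟨Y, hXY⟩ := Submodule.exists_isCompl X
  set U := Submodule.span F {v} ⊔ Y with hU
  have hvU : v ∈ U := Submodule.mem_sup_left (Submodule.mem_span_singleton_self v)
  have hdisj : Disjoint W U := by
    rw [Submodule.disjoint_def]
    intro u huW hu
    obtain ⟨a, ha, y, hy, rfl⟩ := Submodule.mem_sup.mp hu
    obtain ⟨t, rfl⟩ := Submodule.mem_span_singleton.mp ha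
    have hvX : v ∈ X := by simpa using hRX 1 R.one_mem
    have hyX : y ∈ X := by
      simpa using X.sub_mem (hWX huW) (X.smul_mem t hvX)
    have hy0 : y = 0 := (Submodule.disjoint_def.mp hXY.disjoint) y hyX hy
    subst hy0
    rw [add_zero] at huW ⊢
    by_cases ht : t = 0
    · simp [ht]
    · exact (hv ((W.smul_mem_iff ht).mp huW)).elim
  obtain ⟨W', hWW', hc⟩ := hdisj.exists_isCompl
  have hdimX : finrank F R + finrank F W ≤ finrank F X + finrank F J := by
    have hrn := LinearMap.finrank_range_add_finrank_ker ψ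
    rw [Module.finrank_prod] at hrn
    -- If `r v ∈ W`, then `r` is not invertible in `R`, because `v ∉ W`; so `r ∈ J`.
    have hmem : ∀ z : LinearMap.ker ψ, ((z : R × W).1 : End F V) ∈ J := by
      rintro ⟨⟨r, w⟩, hz⟩
      have hz' : (r : End F V) v + w = 0 := hz
      refine (hinv r r.2).resolve_right ?_
      rintro ⟨b, hb, hbr⟩
      have hrv : (r : End F V) v ∈ W := by
        rw [eq_neg_of_add_eq_zero_left hz']
        exact W.neg_mem w.2
      have hbv := hRW b hb _ hrv
      rw [← Module.End.mul_apply, hbr] at hbv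
      exact hv hbv
    let θ : LinearMap.ker ψ →ₗ[F] J :=
      (R.val.toLinearMap ∘ₗ LinearMap.fst F R W ∘ₗ (LinearMap.ker ψ).subtype).codRestrict J hmem
    have hθ : finrank F (LinearMap.ker ψ) ≤ finrank F J := by
      refine LinearMap.finrank_le_finrank_of_injective (f := θ) ?_
      rintro ⟨⟨r, w⟩, hz⟩ ⟨⟨r', w'⟩, hz'⟩ h0
      obtain rfl : r = r' := Subtype.ext (show (r : End F V) = r' from
        congrArg (fun z : J => (z : End F V)) h0)
      have hw : (r : End F V) v + w = 0 := hz
      have hw' : (r : End F V) v + w' = 0 := hz'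
      obtain rfl : w = w' := Subtype.ext (add_left_cancel (hw.trans hw'.symm))
      rfl
    rw [← hX] at hrn
    omega
  have hdimY := Submodule.finrank_add_eq_of_isCompl hXY
  have hdimU : finrank F U ≤ 1 + finrank F Y :=
    (Submodule.finrank_add_le_finrank_add_finrank _ _).trans
      (Nat.add_le_add_right
      (finrank_span_singleton fun h0 : v = 0 => hv (by rw [h0]; exact W.zero_mem)).le _)
  have hU1 : 1 ≤ finrank F U := by
    rw [Nat.one_le_iff_ne_zero, Ne, Submodule.finrank_eq_zero]
    intro hbot
    rw [hbot, Submodule.mem_bot] at hvU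
    exact hv (hvU ▸ W.zero_mem)
  have hdimV := Submodule.finrank_add_eq_of_isCompl hc
  obtain ⟨k, hk, hle⟩ := exists_sum_sq_le_of_restrict (A := Subalgebra.toSubmodule R) (J := J)
    (U := U) (W := W') (m := m) hJR (fun a ha b hb => hJl a (hJR ha) b hb) hN
    hc.symm.sup_eq_top hWW'
    (by
      intro c _ hcR
      refine eq_zero_of_sup_imageSpan_eq_top hN
        (X := (Subalgebra.toSubmodule R).map (LinearMap.applyₗ v) ⊔ Y) ?_ ?_
      · rw [eq_top_iff, ← hXY.sup_eq_top]
        refine sup_le ?_ (le_sup_right.trans le_sup_left)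
        rintro _ ⟨⟨r, w⟩, rfl⟩
        exact add_mem (Submodule.mem_sup_left (Submodule.mem_sup_left ⟨r, r.2, rfl⟩))
          (Submodule.mem_sup_right w.2)
      · intro n g hg x hx
        obtain ⟨_, ⟨r, hr, rfl⟩, y, hy, rfl⟩ := Submodule.mem_sup.mp hx
        have h1 := hcR (g * r) (R.mul_mem (hJpow n g hg) hr) v hvU
        have h2 := hcR g (hJpow n g hg) y (Submodule.mem_sup_right hy)
        rw [map_add, map_add, h2, add_zero]
        exact h1)
    hlie fun K hK hKN hKlie => exists_sum_sq_le_of_nilpotent m hK hKN hKlie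
  refine ⟨Fin.cons (finrank F U) k, ?_, ?_⟩
  · rw [Fin.sum_univ_succ]
    simp only [Fin.cons_zero, Fin.cons_succ, hk]
    rw [add_comm]
    exact hdimV
  · rw [Fin.sum_univ_succ, ← hdimV]
    simp only [Fin.cons_zero, Fin.cons_succ]
    have hWle : finrank F W ≤ finrank F W' := Submodule.finrank_mono hWW'
    have hJle : finrank F J ≤ finrank F R := Submodule.finrank_mono hJR
    obtain ⟨d, hd⟩ := Nat.exists_eq_add_of_le hJle
    rw [← hWdef] at hle
    -- `d` is the dimension of the residue ring `R / J`.
    have h1 : finrank F W + d ≤ finrank F W' + 1 := by omega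
    have h2 : d + finrank F U * finrank F W ≤ finrank F U * finrank F W' + 1 := by
      rcases Nat.eq_zero_or_pos d with rfl | hd0
      · nlinarith
      · obtain ⟨d, rfl⟩ := Nat.exists_eq_add_of_le hd0
        nlinarith
    nlinarith
end Local

/-! ### Splitting along central idempotents -/

/-- The numerical bound is superadditive for `l ≥ 2`: permuting the entries of `k'` makes one of
the products `kᵢ k'ⱼ` with `i ≠ j` positive, which makes up for the unit `1` counted once in each
of the two bounds. -/
theorem exists_sum_sq_add {l n n' d d' : ℕ} (hn : 0 < n) (hn' : 0 < n')
    {k k' : Fin (l + 2) → ℕ} (hk : ∑ i, k i = n) (hk' : ∑ i, k' i = n')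
    (hd : 2 * d + ∑ i, k i ^ 2 ≤ n ^ 2 + 2) (hd' : 2 * d' + ∑ i, k' i ^ 2 ≤ n' ^ 2 + 2) :
    ∃ k'' : Fin (l + 2) → ℕ, ∑ i, k'' i = n + n' ∧
      2 * (d + d') + ∑ i, k'' i ^ 2 ≤ (n + n') ^ 2 + 2 := by
  obtain ⟨i, -, hi⟩ : ∃ i ∈ Finset.univ, k i ≠ 0 :=
    Finset.exists_ne_zero_of_sum_ne_zero (by omega)
  obtain ⟨j, -, hj⟩ : ∃ j ∈ Finset.univ, k' j ≠ 0 :=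
    Finset.exists_ne_zero_of_sum_ne_zero (by omega)
  obtain ⟨i', hi'⟩ := exists_ne i
  let σ : Equiv.Perm (Fin (l + 2)) := Equiv.swap j i'
  have hσ1 : ∑ a, k' (σ a) = n' := (Equiv.sum_comp σ k').trans hk'
  have hσ2 : ∑ a, k' (σ a) ^ 2 = ∑ a, k' a ^ 2 := Equiv.sum_comp σ fun a => k' a ^ 2
  have hσ : k' (σ i') ≠ 0 := by simpa [σ] using hj
  have hcross : ∑ a, k a * k' (σ a) + 1 ≤ n * n' := by
    rw [← hk, ← hσ1, Finset.sum_mul_sum]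
    have h1 : ∀ a, k a * k' (σ a) ≤ ∑ b, k a * k' (σ b) := fun a =>
      Finset.single_le_sum (f := fun b => k a * k' (σ b)) (fun _ _ => Nat.zero_le _)
        (Finset.mem_univ a)
    refine Nat.succ_le_of_lt (Finset.sum_lt_sum (fun a _ => h1 a) ⟨i, Finset.mem_univ i, ?_⟩)
    exact Finset.single_lt_sum (f := fun b => k i * k' (σ b)) hi' (Finset.mem_univ i)
      (Finset.mem_univ i') (Nat.pos_of_ne_zero (mul_ne_zero hi hσ)) fun _ _ _ => Nat.zero_le _
  refine ⟨fun a => k a + k' (σ a), by rw [Finset.sum_add_distrib, hk, hσ1], ?_⟩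
  have hsq : ∑ a, (k a + k' (σ a)) ^ 2 =
      ∑ a, k a ^ 2 + 2 * ∑ a, k a * k' (σ a) + ∑ a, k' a ^ 2 := by
    rw [← hσ2, Finset.mul_sum, ← Finset.sum_add_distrib, ← Finset.sum_add_distrib]
    exact Finset.sum_congr rfl fun a _ => by ring
  rw [hsq]
  nlinarith

theorem finrank_le_add_of_jointly_injective {F A B C : Type*} [Field F] [Ring A] [Ring B] [Ring C]
    [Algebra F A] [Algebra F B] [Algebra F C] [FiniteDimensional F A] (f : A →ₐ[F] B)
    (g : A →ₐ[F] C) (h : ∀ a, f a = 0 → g a = 0 → a = 0) :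
    finrank F A ≤ finrank F f.range + finrank F g.range := by
  have : FiniteDimensional F f.range := .of_surjective f.rangeRestrict.toLinearMap
    f.rangeRestrict_surjective
  have : FiniteDimensional F g.range := .of_surjective g.rangeRestrict.toLinearMap
    g.rangeRestrict_surjective
  let θ : A →ₗ[F] f.range × g.range :=
    f.rangeRestrict.toLinearMap.prod g.rangeRestrict.toLinearMap
  rw [← Module.finrank_prod]
  refine LinearMap.finrank_le_finrank_of_injective (f := θ)
    ((injective_iff_map_eq_zero θ).mpr fun a ha => ?_)
  exact h a (congrArg (fun z : f.range × g.range => (z.1 : B)) ha)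
    (congrArg (fun z : f.range × g.range => (z.2 : C)) ha)

section Split
universe u v
variable {F : Type u} [Field F]

/-- The dimension bound in terms of natural numbers. An idempotent `e ≠ 0, 1` of `R` is central,
so `R` embeds into the product of its images in the endomorphisms of the range and the kernel of
`e`; if there is none, the local case applies. -/
theorem exists_sum_sq_le_of_lieNilpotent {V : Type v} [AddCommGroup V] [Module F V]
    [FiniteDimensional F V] [Nontrivial V] {R : Subalgebra F (End F V)} {m : ℕ}
    (hR : IsLieNilpotentOfIndex R (m + 1)) :
    ∃ k : Fin (m + 2) → ℕ, ∑ i, k i = finrank F V ∧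
      2 * finrank F R + ∑ i, k i ^ 2 ≤ finrank F V ^ 2 + 2 := by
  induction hn : finrank F V using Nat.strong_induction_on generalizing V with
  | _ n ih =>
  by_cases h : ∀ e ∈ R, e * e = e → e = 0 ∨ e = 1
  · rw [← hn]
    refine exists_sum_sq_le_of_idempotent_trivial h fun x hx => ?_
    have h1 := map_leftNormedBracket R.val.toRingHom (fun i => ⟨x i, hx i⟩) (m + 1)
    rw [hR, map_zero] at h1
    exact h1.symm
  push Not at h
  obtain ⟨e, heR, he, he0, he1⟩ := h
  have hcomm : ∀ r ∈ R, ∀ v, e (r v) = r (e v) := fun r hr v =>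
    LinearMap.congr_fun (congrArg Subtype.val
      (hR.commute_of_idempotent (e := ⟨e, heR⟩) (Subtype.ext he) ⟨r, hr⟩)) v
  have hee : ∀ v, e (e v) = e v := fun v => LinearMap.congr_fun he v
  set V₁ := LinearMap.range e with hV₁
  set V₂ := LinearMap.ker e with hV₂
  have h₁ : R ≤ endStabilizer V₁ := by
    rintro r hr _ ⟨v, rfl⟩
    exact ⟨r v, hcomm r hr v⟩
  have h₂ : R ≤ endStabilizer V₂ := by
    intro r hr v hv
    rw [hV₂, LinearMap.mem_ker] at hv ⊢
    rw [hcomm r hr, hv, map_zero]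
  have hdim : finrank F V₁ + finrank F V₂ = n := by
    rw [← hn]; exact LinearMap.finrank_range_add_finrank_ker e
  have hpos₁ : 0 < finrank F V₁ := by
    rw [Nat.pos_iff_ne_zero, Ne, Submodule.finrank_eq_zero, hV₁, LinearMap.range_eq_bot]
    exact he0
  have hpos₂ : 0 < finrank F V₂ := by
    rw [Nat.pos_iff_ne_zero, Ne, Submodule.finrank_eq_zero, hV₂]
    intro hker
    refine he1 (LinearMap.ext fun v => ?_)
    exact LinearMap.ker_eq_bot.mp hker (hee v)
  have : Nontrivial V₁ := Module.finrank_pos_iff.mp hpos₁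
  have : Nontrivial V₂ := Module.finrank_pos_iff.mp hpos₂
  let f₁ : R →ₐ[F] End F V₁ := (restrictEnd V₁).comp (Subalgebra.inclusion h₁)
  let f₂ : R →ₐ[F] End F V₂ := (restrictEnd V₂).comp (Subalgebra.inclusion h₂)
  obtain ⟨k₁, hk₁, hle₁⟩ := ih _ (by omega) (V := V₁) (R := f₁.range)
    (hR.of_surjective f₁.rangeRestrict.toRingHom f₁.rangeRestrict_surjective) rfl
  obtain ⟨k₂, hk₂, hle₂⟩ := ih _ (by omega) (V := V₂) (R := f₂.range)
    (hR.of_surjective f₂.rangeRestrict.toRingHom f₂.rangeRestrict_surjective) rfl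
  obtain ⟨k, hk, hle⟩ := exists_sum_sq_add hpos₁ hpos₂ hk₁ hk₂ hle₁ hle₂
  rw [hdim] at hk hle
  refine ⟨k, hk, ?_⟩
  have hfin : finrank F R ≤ finrank F f₁.range + finrank F f₂.range := by
    refine finrank_le_add_of_jointly_injective f₁ f₂ fun r hr₁ hr₂ => ?_
    refine Subtype.ext (LinearMap.ext fun v => ?_)
    have h₁v : (r : End F V) (e v) = 0 :=
      congrArg Subtype.val (LinearMap.congr_fun hr₁ ⟨e v, ⟨v, rfl⟩⟩)
    have h₂v : (r : End F V) (v - e v) = 0 := congrArg Subtype.val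
      (LinearMap.congr_fun hr₂ ⟨v - e v, by rw [hV₂, LinearMap.mem_ker, map_sub, hee, sub_self]⟩)
    rw [map_sub, h₁v, sub_zero] at h₂v
    exact h₂v
  omega

end Split

/-! ### Matrices and the value of the bound -/

theorem IsLieNilpotentOfIndex.finrank_le_lieBound {F : Type*} [Field F] {n m : ℕ} (hn : 0 < n)
    (hm : 0 < m) {R : Subalgebra F (Matrix (Fin n) (Fin n) F)} (hR : IsLieNilpotentOfIndex R m) :
    (Module.finrank F R : ℝ) ≤ lieBound (m + 1) n := by
  obtain ⟨m, rfl⟩ := Nat.exists_eq_succ_of_ne_zero hm.ne'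
  have : Nonempty (Fin n) := ⟨⟨0, hn⟩⟩
  let φ : R ≃ₐ[F] R.map (Matrix.toLinAlgEquiv' : _ ≃ₐ[F] End F (Fin n → F)).toAlgHom :=
    R.equivMapOfInjective _ Matrix.toLinAlgEquiv'.injective
  obtain ⟨k, hk, hle⟩ := exists_sum_sq_le_of_lieNilpotent
    (hR.of_surjective φ.toAlgHom.toRingHom φ.surjective)
  rw [← φ.toLinearEquiv.finrank_eq, Module.finrank_fin_fun] at hle
  rw [Module.finrank_fin_fun] at hk
  refine le_trans ?_ ((lieBound_isGreatest (m + 1 + 1) n (by omega)).2 ⟨k, hk, rfl⟩)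
  have hle' : (2 * finrank F R + ∑ i, (k i : ℝ) ^ 2 : ℝ) ≤ (n : ℝ) ^ 2 + 2 := by
    exact_mod_cast hle
  linarith

theorem lieBound_two (n : ℕ) : lieBound 2 n = (⌊(n : ℝ) ^ 2 / 4⌋₊ : ℝ) + 1 := by
  have hfloor : ⌊(n : ℝ) ^ 2 / 4⌋₊ = n ^ 2 / 4 := by
    have := Nat.floor_div_eq_div (K := ℝ) (n ^ 2) 4
    exact_mod_cast this
  rw [hfloor]
  have hval : ∀ a b : ℕ, a + b = n →
      (1 / 2 * ((n : ℝ) ^ 2 - ((a : ℝ) ^ 2 + (b : ℝ) ^ 2)) + 1 : ℝ) = ((a * b : ℕ) : ℝ) + 1 := by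
    rintro a b rfl
    push_cast
    ring
  refine (lieBound_isGreatest 2 n two_pos).unique ⟨?_, ?_⟩
  · refine ⟨![n / 2, n - n / 2], by simp; omega, ?_⟩
    have h : n / 2 * (n - n / 2) = n ^ 2 / 4 := by
      obtain ⟨t, rfl | rfl⟩ := Nat.even_or_odd' n
      · rw [Nat.mul_div_cancel_left t two_pos, show 2 * t - t = t by omega,
          show (2 * t) ^ 2 = 4 * (t * t) by ring, Nat.mul_div_cancel_left _ (by norm_num)]
      · rw [show (2 * t + 1) / 2 = t by omega, show 2 * t + 1 - t = t + 1 by omega,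
          show (2 * t + 1) ^ 2 = 4 * (t * (t + 1)) + 1 by ring]
        omega
    rw [← h, ← hval _ _ (show n / 2 + (n - n / 2) = n by omega)]
    simp [Fin.sum_univ_two]
  · rintro _ ⟨k, hk, rfl⟩
    rw [Fin.sum_univ_two] at hk ⊢
    rw [hval _ _ hk]
    have h : k 0 * k 1 ≤ n ^ 2 / 4 := by
      rw [Nat.le_div_iff_mul_le (by norm_num), ← hk, mul_comm, ← mul_assoc]
      exact four_mul_le_sq_add (k 0) (k 1)
    exact_mod_cast Nat.add_le_add_right h 1

theorem mainTheorem1 {F : Type*} [Field F] (n : ℕ) (hn : 0 < n) :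
    (∀ m : ℕ, 0 < m → ∀ R : Subalgebra F (Matrix (Fin n) (Fin n) F),
      IsLieNilpotentOfIndex R m → (Module.finrank F R : ℝ) ≤ lieBound (m + 1) n) ∧
    lieBound 2 n = (⌊(n : ℝ) ^ 2 / 4⌋₊ : ℝ) + 1 ∧
    (∀ R : Subalgebra F (Matrix (Fin n) (Fin n) F), (∀ a ∈ R, ∀ b ∈ R, a * b = b * a) →
      Module.finrank F R ≤ ⌊(n : ℝ) ^ 2 / 4⌋₊ + 1) := by
  refine ⟨fun m hm R hR => hR.finrank_le_lieBound hn hm, lieBound_two n, fun R hR => ?_⟩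
  have hlie : IsLieNilpotentOfIndex R 1 := fun x => by
    rw [leftNormedBracket, leftNormedBracket, Ring.lie_def, sub_eq_zero]
    exact Subtype.ext (hR _ (x 0).2 _ (x 1).2)
  have h := hlie.finrank_le_lieBound hn one_pos
  rw [lieBound_two] at h
  exact_mod_cast h
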